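/- All spaces are $T_0$. A space is sober if it is $T_0$ and every irreducible closed set is the closure of a point. A **K-category** $\mathcal K$ is a full subcategory of the category of $T_0$ spaces, whose objects are called $\mathcal K$-spaces, such that: (1) homeomorphic copies of $\mathcal K$-spaces are $\mathcal K$-spaces; (2) all sober spaces are $\mathcal K$-spaces; (3) in a sober space the intersection of any family of $\mathcal K$-subspaces is a $\mathcal K$-subspace; (4) for each continuous map $f:S\to T$ between sober spaces and each $\mathcal K$-subspace $A$ of $T$, $f^{-1}(A)$ is a $\mathcal K$-subspace of $S$. For a space $X$ let $X^{\mathrm s}$ be its sobrification (the irreducible closed subsets of $X$ with the lower Vietoris topology), let $\mathcal K_{\mathrm c}(X)$ be the smallest $\mathcal K$-subspace of $X^{\mathrm s}$ containing all $\overline{\{x\}}$, $x\in X$, and let $\eta_X:X\to\mathcal K_{\mathrm c}(X)$, $x\mapsto\overline{\{x\}}$. For a continuous map $f:X\to Y$, $\mathcal K_{\mathrm c}(f):\mathcal K_{\mathrm c}(X)\to\mathcal K_{\mathrm c}(Y)$ is the continuous map with $\mathcal K_{\mathrm c}(f)\circ\eta_X=\eta_Y\circ f$, given by $A\mapsto\overline{f(A)}$.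 A **cone** is a commutative monoid $(C,+,0)$ with a scalar multiplication $\mathbb R_+\times C\to C$ satisfying the vector space axioms ($\mathbb R_+=[0,\infty)$). A **topological cone** is a cone with a $T_0$ topology for which addition $C\times C\to C$ and scalar multiplication $\mathbb R_+\times C\to C$ are jointly continuous, $\mathbb R_+$ carrying the Scott topology. It is **weakly locally convex** if every open neighbourhood of a point $x$ contains a convex (not necessarily open) neighbourhood of $x$. A **$\mathcal K$-cone** is a topological cone that is a $\mathcal K$-space. A map between cones is linear if it is additive and homogeneous. Let $\mathcal V_w X$ be the cone of continuous valuations on $X$ (functions from the open sets to $[0,\infty]$ that are strict, monotone, modular and Scott-continuous), with pointwise operations and the weak topology generated by the sets $\{\mu\mid\mu(U)>r\}$ ($U$ open, $r\in\mathbb R_+$). Let $\mathcal V_{\mathrm s}X\subseteq\mathcal V_wX$ be the subspace and subcone of simple valuations $\sum_{i=1}^n r_i\delta_{x_i}$ ($r_i\in\mathbb R_+$, $x_i\in X$), and $\delta^{\mathrm s}_X:X\to\mathcal V_{\mathrm s}X$, $x\mapsto\delta_x$. The space $\mathcal K_{\mathrm c}(\mathcal V_{\mathrm s}X)$ is identified,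 by the canonical homeomorphism extending the inclusion of $\mathcal V_{\mathrm s} X$, with the smallest $\mathcal K$-subspace of $\mathcal V_wX$ containing $\mathcal V_{\mathrm s}X$, which is a subcone of $\mathcal V_wX$; the addition and scalar multiplication of $\mathcal K_{\mathrm c}(\mathcal V_{\mathrm s}X)$ are the pointwise ones. **Proposition.** Let $\mathcal K$ be a K-category and let $C$ be a weakly locally convex topological cone. There is a unique continuous map $\alpha_C:\mathcal V_{\mathrm s}C\to C$ that is the structure map of the $\mathcal V_{\mathrm s}$-algebra at $C$, that is, $\alpha_C$ is linear, $\alpha_C(\sum_i r_i\delta_{x_i})=\sum_i r_ix_i$, and the Eilenberg–Moore laws $\alpha_C(\delta_x)=x$ and $\alpha_C(\sum_i r_i\delta_{\alpha_C(\mu_i)})=\alpha_C(\sum_i r_i\mu_i)$ hold. The operations $$x+y=\mathcal K_{\mathrm c}(\alpha_C)\bigl(\mathcal K_{\mathrm c}(\delta^{\mathrm s}_C)(x)+\mathcal K_{\mathrm c}(\delta^{\mathrm s}_C)(y)\bigr),\qquad r\cdot x=\mathcal K_{\mathrm c}(\alpha_C)\bigl(r\,\mathcal K_{\mathrm c}(\delta^{\mathrm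 s}_C)(x)\bigr)\qquad(x,y\in\mathcal K_{\mathrm c}(C),\ r\in\mathbb R_+)$$ make $\mathcal K_{\mathrm c}(C)$ a cone, and with this cone structure $\mathcal K_{\mathrm c}(C)$ is a weakly locally convex topological $\mathcal K$-cone. Moreover, $\eta_C:C\to\mathcal K_{\mathrm c}(C)$ is a topological embedding and is linear with respect to this cone structure. -/

import Mathlib

open Set Topology TopologicalSpace
open scoped NNReal ENNReal

universe u

/-! ### Cones

A cone is a commutative monoid with a scalar multiplication by nonnegative reals satisfying the
vector space axioms, that is, a module over the semiring `ℝ≥0`. -/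

/-- A topological cone: a cone with a `T₀` topology such that addition and scalar multiplication
are jointly continuous, where the nonnegative reals carry the Scott topology. -/
structure IsTopologicalCone (C : Type*) [TopologicalSpace C] [AddCommMonoid C] [Module ℝ≥0 C] :
    Prop where
  t0 : T0Space C
  continuous_add : Continuous fun p : C × C => p.1 + p.2
  continuous_smul : Continuous fun p : WithScott ℝ≥0 × C => WithScott.ofScott p.1 • p.2

/-- Weak local convexity: every open neighbourhood of a point contains a convex, not necessarily
open, neighbourhood of that point. -/
def IsWeaklyLocallyConvex (C : Type*) [TopologicalSpace C] [AddCommMonoid C] [Module ℝ≥0 C] :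
    Prop :=
  ∀ x : C, ∀ U : Set C, IsOpen U → x ∈ U → ∃ A ∈ 𝓝 x, A ⊆ U ∧ Convex ℝ≥0 A

/-! ### The canonical sobrification -/

/-- The canonical sobrification `Xˢ`: the set of irreducible closed subsets of `X`. -/
structure Sobrification (X : Type u) [TopologicalSpace X] where
  carrier : Set X
  irred : IsIrreducible carrier
  closed : IsClosed carrier

namespace Sobrification

variable {X Y : Type u} [TopologicalSpace X] [TopologicalSpace Y]

theorem ext' {A B : Sobrification X} (h : A.carrier = B.carrier) : A = B := by
  cases A; cases B; cases h; rfl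

/-- The irreducible closed sets that meet `U`. -/
def hit (U : Opens X) : Set (Sobrification X) := {A | (A.carrier ∩ U).Nonempty}

/-- The lower Vietoris topology. -/
instance : TopologicalSpace (Sobrification X) :=
  generateFrom (range hit)

theorem hit_inf (U V : Opens X) : hit (U ⊓ V) = hit U ∩ hit V := by
  ext A
  constructor
  · rintro ⟨x, hx, hU, hV⟩
    exact ⟨⟨x, hx, hU⟩, ⟨x, hx, hV⟩⟩
  · rintro ⟨hU, hV⟩
    exact A.irred.2 U V U.isOpen V.isOpen hU hV

theorem isOpen_hit (U : Opens X) : IsOpen (hit U) := isOpen_generateFrom_of_mem ⟨U, rfl⟩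

theorem isOpen_iff {s : Set (Sobrification X)} : IsOpen s ↔ ∃ U : Opens X, s = hit U := by
  constructor
  · intro h
    induction h with
    | basic s hs => obtain ⟨U, rfl⟩ := hs; exact ⟨U, rfl⟩
    | univ =>
      refine ⟨⊤, ?_⟩
      ext A
      simpa [hit] using A.irred.1
    | inter s t _ _ hs ht =>
      obtain ⟨U, rfl⟩ := hs
      obtain ⟨V, rfl⟩ := ht
      exact ⟨U ⊓ V, (hit_inf U V).symm⟩
    | sUnion S _ ih =>
      refine ⟨sSup {U | hit U ∈ S}, ?_⟩
      ext A
      constructor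
      · rintro ⟨s, hs, hA⟩
        obtain ⟨U, rfl⟩ := ih s hs
        obtain ⟨x, hx, hxU⟩ := hA
        exact ⟨x, hx, Opens.mem_sSup.2 ⟨U, hs, hxU⟩⟩
      · rintro ⟨x, hx, hxU⟩
        obtain ⟨U, hU, hxU⟩ := Opens.mem_sSup.1 hxU
        exact ⟨hit U, hU, ⟨x, hx, hxU⟩⟩
  · rintro ⟨U, rfl⟩
    exact isOpen_hit U

instance : T0Space (Sobrification X) := by
  rw [t0Space_iff_inseparable]
  have key : ∀ A B : Sobrification X, Inseparable A B → A.carrier ⊆ B.carrier := by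
    intro A B h x hx
    by_contra hxB
    have h1 : A ∈ hit (⟨B.carrierᶜ, B.closed.isOpen_compl⟩ : Opens X) := ⟨x, hx, hxB⟩
    obtain ⟨y, hy, hy'⟩ := (h.mem_open_iff (isOpen_hit _)).1 h1
    exact hy' hy
  intro A B h
  exact ext' ((key A B h).antisymm (key B A h.symm))

instance : QuasiSober (Sobrification X) := by
  refine ⟨fun {S} hS hSc => ?_⟩
  set N : Opens X := sSup {U : Opens X | hit U ∩ S = ∅} with hN
  have meet : ∀ U : Opens X, (((N : Set X)ᶜ) ∩ U).Nonempty ↔ (S ∩ hit U).Nonempty := by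
    intro U
    constructor
    · rintro ⟨x, hx, hxU⟩
      by_contra hne
      apply hx
      refine Opens.mem_sSup.2 ⟨U, ?_, hxU⟩
      change hit U ∩ S = ∅
      rw [inter_comm]
      exact not_nonempty_iff_eq_empty.1 hne
    · rintro ⟨A, hAS, hAU⟩
      by_contra hne
      have hUN : (U : Set X) ⊆ N := by
        intro x hx
        by_contra hxN
        exact hne ⟨x, hxN, hx⟩
      obtain ⟨x, hxA, hxU⟩ := hAU
      obtain ⟨V, hV, hxV⟩ := Opens.mem_sSup.1 (hUN hxU)
      have : A ∈ hit V ∩ S := ⟨⟨x, hxA, hxV⟩, hAS⟩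
      rw [hV] at this
      exact this
  have irr : IsIrreducible ((N : Set X)ᶜ) := by
    refine ⟨?_, ?_⟩
    · obtain ⟨A, hA⟩ := hS.1
      obtain ⟨x, hx, -⟩ := (meet ⊤).2 ⟨A, hA, by simpa [hit] using A.irred.1⟩
      exact ⟨x, hx⟩
    · intro u v hu hv h1 h2
      have h1' := (meet ⟨u, hu⟩).1 h1
      have h2' := (meet ⟨v, hv⟩).1 h2
      have := hS.2 _ _ (isOpen_hit _) (isOpen_hit _) h1' h2'
      rw [← hit_inf] at this
      exact (meet _).2 this
  refine ⟨⟨(N : Set X)ᶜ, irr, N.isOpen.isClosed_compl⟩, ?_⟩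
  rw [IsGenericPoint]
  ext B
  rw [← hSc.closure_eq]
  simp only [mem_closure_iff]
  constructor
  · intro h o ho hB
    obtain ⟨U, rfl⟩ := isOpen_iff.1 ho
    obtain ⟨A, hA, rfl⟩ := h _ ho hB
    rw [inter_comm]
    exact (meet U).1 hA
  · intro h o ho hB
    obtain ⟨U, rfl⟩ := isOpen_iff.1 ho
    have := h _ ho hB
    rw [inter_comm] at this
    exact ⟨_, (meet U).2 this, rfl⟩

/-- The canonical map of `X` into its sobrification, `x ↦ closure {x}`. -/
def unit (x : X) : Sobrification X := ⟨closure {x}, isIrreducible_singleton.closure, isClosed_closure⟩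

theorem unit_mem_hit (x : X) (U : Opens X) : unit x ∈ hit U ↔ x ∈ U := by
  constructor
  · rintro ⟨y, hy, hyU⟩
    obtain ⟨z, hz, rfl⟩ := mem_closure_iff.1 hy U U.isOpen hyU
    exact hz
  · intro h
    exact ⟨x, subset_closure rfl, h⟩

theorem continuous_unit : Continuous (unit : X → Sobrification X) := by
  refine continuous_generateFrom_iff.2 ?_
  rintro _ ⟨U, rfl⟩
  have : unit ⁻¹' hit U = (U : Set X) := by ext x; exact unit_mem_hit x U
  rw [this]
  exact U.isOpen

/-- The sobrification functor on maps: `A ↦ closure (f '' A)`. -/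
def map (f : C(X, Y)) (A : Sobrification X) : Sobrification Y :=
  ⟨closure (f '' A.carrier), (A.irred.image f f.continuous.continuousOn).closure, isClosed_closure⟩

theorem map_mem_hit (f : C(X, Y)) (A : Sobrification X) (U : Opens Y) :
    map f A ∈ hit U ↔ A ∈ hit (Opens.comap f U) := by
  constructor
  · rintro ⟨y, hy, hyU⟩
    obtain ⟨_, hz, x, hx, rfl⟩ := mem_closure_iff.1 hy U U.isOpen hyU
    exact ⟨x, hx, hz⟩
  · rintro ⟨x, hx, hxU⟩
    exact ⟨f x, subset_closure ⟨x, hx, rfl⟩, hxU⟩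

theorem continuous_map (f : C(X, Y)) : Continuous (map f) := by
  refine continuous_generateFrom_iff.2 ?_
  rintro _ ⟨U, rfl⟩
  have : map f ⁻¹' hit U = hit (Opens.comap f U) := by ext A; exact map_mem_hit f A U
  rw [this]
  exact isOpen_hit _

theorem eq_of_hit {A B : Sobrification X} (h : ∀ U, A ∈ hit U ↔ B ∈ hit U) : A = B := by
  have : Inseparable A B := by
    rw [inseparable_iff_forall_isOpen]
    intro s hs
    obtain ⟨U, rfl⟩ := isOpen_iff.1 hs
    exact h U
  exact this.eq

theorem map_unit (f : C(X, Y)) (x : X) : map f (unit x) = unit (f x) := by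
  refine eq_of_hit fun U => ?_
  rw [map_mem_hit, unit_mem_hit, unit_mem_hit]
  rfl

end Sobrification

/-! ### K-categories and the K-completion -/

/-- A `K`-category: a full subcategory of the category of `T₀` spaces, given by its class of
objects (the `𝒦`-spaces), with the four closure properties of Keimel and Lawson. A space is sober
when it is `T₀` and quasi-sober. -/
structure KCategory where
  IsKSpace : ∀ (X : Type u) [TopologicalSpace X], Prop
  t0 : ∀ (X : Type u) [TopologicalSpace X], IsKSpace X → T0Space X
  of_homeomorph : ∀ (X Y : Type u) [TopologicalSpace X] [TopologicalSpace Y],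
    (X ≃ₜ Y) → IsKSpace X → IsKSpace Y
  of_sober : ∀ (X : Type u) [TopologicalSpace X] [T0Space X] [QuasiSober X], IsKSpace X
  sInter : ∀ (S : Type u) [TopologicalSpace S] [T0Space S] [QuasiSober S] (𝒜 : Set (Set S)),
    (∀ A ∈ 𝒜, IsKSpace A) → IsKSpace (⋂₀ 𝒜 : Set S)
  preimage : ∀ (S T : Type u) [TopologicalSpace S] [TopologicalSpace T] [T0Space S] [QuasiSober S]
    [T0Space T] [QuasiSober T] (f : C(S, T)) (A : Set T), IsKSpace A → IsKSpace (f ⁻¹' A)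

namespace KCategory

variable (𝒦 : KCategory.{u})

/-- `cl_k A`: the intersection of all `𝒦`-subspaces of `S` that contain `A`. -/
def cl {S : Type u} [TopologicalSpace S] (A : Set S) : Set S :=
  ⋂₀ {B | A ⊆ B ∧ 𝒦.IsKSpace B}

theorem subset_cl {S : Type u} [TopologicalSpace S] (A : Set S) : A ⊆ 𝒦.cl A :=
  subset_sInter fun _ hB => hB.1

theorem isKSpace_cl {S : Type u} [TopologicalSpace S] [T0Space S] [QuasiSober S] (A : Set S) :
    𝒦.IsKSpace (𝒦.cl A) :=
  𝒦.sInter S _ fun _ hB => hB.2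

theorem cl_subset {S : Type u} [TopologicalSpace S] {A B : Set S} (h : A ⊆ B)
    (hB : 𝒦.IsKSpace B) : 𝒦.cl A ⊆ B :=
  sInter_subset_of_mem ⟨h, hB⟩

theorem mapsTo_cl {S T : Type u} [TopologicalSpace S] [TopologicalSpace T] [T0Space S]
    [QuasiSober S] [T0Space T] [QuasiSober T] {f : S → T} (hf : Continuous f) {A : Set S}
    {B : Set T} (h : MapsTo f A (𝒦.cl B)) : MapsTo f (𝒦.cl A) (𝒦.cl B) :=
  𝒦.cl_subset (B := f ⁻¹' 𝒦.cl B) h (𝒦.preimage S T ⟨f, hf⟩ _ (𝒦.isKSpace_cl B))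

/-- The canonical `𝒦`-completion of `X`: the smallest `𝒦`-subspace of the sobrification of `X`
that contains the image of `X`. -/
def Kc (X : Type u) [TopologicalSpace X] : Type u :=
  𝒦.cl (range (Sobrification.unit : X → Sobrification X))

variable {X Y : Type u} [TopologicalSpace X] [TopologicalSpace Y]

instance : TopologicalSpace (𝒦.Kc X) :=
  inferInstanceAs (TopologicalSpace (𝒦.cl (range (Sobrification.unit : X → Sobrification X))))

/-- The unit of the completion. -/
def η (x : X) : 𝒦.Kc X := ⟨Sobrification.unit x, 𝒦.subset_cl _ ⟨x, rfl⟩⟩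

theorem mapsTo_map (f : C(X, Y)) : MapsTo (Sobrification.map f)
    (𝒦.cl (range (Sobrification.unit : X → Sobrification X)))
    (𝒦.cl (range (Sobrification.unit : Y → Sobrification Y))) := by
  apply 𝒦.mapsTo_cl (Sobrification.continuous_map f)
  rintro _ ⟨x, rfl⟩
  exact 𝒦.subset_cl _ ⟨f x, (Sobrification.map_unit f x).symm⟩

/-- The action of the completion functor on a continuous map `f`. -/
def map (f : C(X, Y)) : C(𝒦.Kc X, 𝒦.Kc Y) where
  toFun := (𝒦.mapsTo_map f).restrict
  continuous_toFun := (Sobrification.continuous_map f).restrict (𝒦.mapsTo_map f)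

theorem map_η (f : C(X, Y)) (x : X) : 𝒦.map f (𝒦.η x) = 𝒦.η (f x) :=
  Subtype.ext (Sobrification.map_unit f x)

end KCategory

/-! ### Continuous valuations -/

/-- A continuous valuation on `X`. -/
@[ext]
structure ContVal (X : Type u) [TopologicalSpace X] where
  toFun : Opens X → ℝ≥0∞
  strict' : toFun ⊥ = 0
  mono' : ∀ U V : Opens X, U ≤ V → toFun U ≤ toFun V
  modular' : ∀ U V : Opens X, toFun U + toFun V = toFun (U ⊔ V) + toFun (U ⊓ V)
  scott' : ∀ D : Set (Opens X), D.Nonempty → DirectedOn (· ≤ ·) D →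
    toFun (sSup D) = ⨆ U ∈ D, toFun U

namespace ContVal

variable {X : Type u} [TopologicalSpace X]

instance : Zero (ContVal X) := ⟨⟨fun _ => 0, rfl, by simp, by simp, by simp⟩⟩

theorem biSup_add_biSup {D : Set (Opens X)} (hd : DirectedOn (· ≤ ·) D)
    {f g : Opens X → ℝ≥0∞} (hf : Monotone f) (hg : Monotone g) :
    (⨆ U ∈ D, f U) + (⨆ U ∈ D, g U) = ⨆ U ∈ D, (f U + g U) := by
  rw [iSup_subtype', iSup_subtype', iSup_subtype', ENNReal.iSup_add_iSup]
  rintro ⟨U, hU⟩ ⟨V, hV⟩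
  obtain ⟨W, hW, h1, h2⟩ := hd U hU V hV
  exact ⟨⟨W, hW⟩, add_le_add (hf h1) (hg h2)⟩

instance : Add (ContVal X) := ⟨fun μ ν =>
  { toFun := fun U => μ.toFun U + ν.toFun U
    strict' := by rw [μ.strict', ν.strict', add_zero]
    mono' := fun U V h => add_le_add (μ.mono' U V h) (ν.mono' U V h)
    modular' := fun U V => by
      rw [add_add_add_comm, μ.modular', ν.modular', add_add_add_comm]
    scott' := fun D hD hd => by
      rw [μ.scott' D hD hd, ν.scott' D hD hd,
        biSup_add_biSup hd (fun U V h => μ.mono' U V h) (fun U V h => ν.mono' U V h)] }⟩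

noncomputable instance : SMul ℝ≥0 (ContVal X) := ⟨fun r μ =>
  { toFun := fun U => (r : ℝ≥0∞) * μ.toFun U
    strict' := by rw [μ.strict', mul_zero]
    mono' := fun U V h => mul_le_mul_right (μ.mono' U V h) _
    modular' := fun U V => by rw [← mul_add, μ.modular', mul_add]
    scott' := fun D hD hd => by simp only [μ.scott' D hD hd, ENNReal.mul_iSup] }⟩

instance : AddCommMonoid (ContVal X) where
  add_assoc μ ν ξ := ContVal.ext (funext fun U => add_assoc _ _ _)
  zero_add μ := ContVal.ext (funext fun U => zero_add _)
  add_zero μ := ContVal.ext (funext fun U => add_zero _)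
  add_comm μ ν := ContVal.ext (funext fun U => add_comm _ _)
  nsmul := nsmulRec

/-- The cone structure on the continuous valuations is the pointwise one. -/
noncomputable instance : Module ℝ≥0 (ContVal X) where
  one_smul μ := ContVal.ext (funext fun U => one_mul _)
  mul_smul r s μ := ContVal.ext (funext fun U => by
    change ((r * s : ℝ≥0) : ℝ≥0∞) * _ = (r : ℝ≥0∞) * ((s : ℝ≥0∞) * _)
    rw [ENNReal.coe_mul, mul_assoc])
  smul_zero r := ContVal.ext (funext fun U => mul_zero _)
  smul_add r μ ν := ContVal.ext (funext fun U => mul_add _ _ _)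
  add_smul r s μ := ContVal.ext (funext fun U => by
    change ((r + s : ℝ≥0) : ℝ≥0∞) * _ = (r : ℝ≥0∞) * _ + (s : ℝ≥0∞) * _
    rw [ENNReal.coe_add, add_mul])
  zero_smul μ := ContVal.ext (funext fun U => zero_mul _)

theorem add_apply (μ ν : ContVal X) (U : Opens X) : (μ + ν).toFun U = μ.toFun U + ν.toFun U := rfl

theorem smul_apply (r : ℝ≥0) (μ : ContVal X) (U : Opens X) :
    (r • μ).toFun U = (r : ℝ≥0∞) * μ.toFun U := rfl

/-- The subbasic set `[U > r]`. -/
def above (U : Opens X) (r : ℝ≥0) : Set (ContVal X) := {μ | (r : ℝ≥0∞) < μ.toFun U}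

/-- The weak topology. -/
instance : TopologicalSpace (ContVal X) :=
  generateFrom {s | ∃ (U : Opens X) (r : ℝ≥0), s = above U r}

theorem isOpen_above (U : Opens X) (r : ℝ≥0) : IsOpen (above U r) :=
  isOpen_generateFrom_of_mem ⟨U, r, rfl⟩

theorem le_of_specializes {μ ν : ContVal X} (h : ν ⤳ μ) (U : Opens X) :
    μ.toFun U ≤ ν.toFun U := by
  refine ENNReal.le_of_forall_nnreal_lt fun r hr => ?_
  exact (h.mem_open (isOpen_above U r) hr : (r : ℝ≥0∞) < ν.toFun U).le

theorem specializes_of_le {μ ν : ContVal X} (h : ∀ U, μ.toFun U ≤ ν.toFun U) : ν ⤳ μ := by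
  rw [specializes_iff_forall_open]
  intro s hs hμ
  induction hs with
  | basic s hs => obtain ⟨U, r, rfl⟩ := hs; exact lt_of_lt_of_le hμ (h U)
  | univ => trivial
  | inter s t _ _ h1 h2 => exact ⟨h1 hμ.1, h2 hμ.2⟩
  | sUnion S _ ih => obtain ⟨s, hs, hm⟩ := hμ; exact ⟨s, hs, ih s hs hm⟩

instance : T0Space (ContVal X) := by
  rw [t0Space_iff_inseparable]
  intro μ ν h
  exact ContVal.ext (funext fun U =>
    le_antisymm (le_of_specializes h.specializes' U) (le_of_specializes h.specializes U))

/-- The pointwise supremum of an irreducible set of continuous valuations. -/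
noncomputable def supr (A : Set (ContVal X)) (hA : IsIrreducible A) : ContVal X where
  toFun U := ⨆ μ ∈ A, μ.toFun U
  strict' := by simp [strict']
  mono' U V h := iSup₂_mono fun μ _ => μ.mono' U V h
  modular' := by
    have main : ∀ U V U' V' : Opens X,
        (∀ μ : ContVal X, μ.toFun U + μ.toFun V ≤ μ.toFun U' + μ.toFun V') →
        (⨆ μ ∈ A, μ.toFun U) + (⨆ μ ∈ A, μ.toFun V) ≤
          (⨆ μ ∈ A, μ.toFun U') + (⨆ μ ∈ A, μ.toFun V') := by
      intro U V U' V' h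
      have := hA.1.to_subtype
      have dist : (⨆ μ ∈ A, μ.toFun U) + (⨆ μ ∈ A, μ.toFun V) =
          ⨆ μ : A, ⨆ ν : A, ((μ : ContVal X).toFun U + (ν : ContVal X).toFun V) := by
        rw [iSup_subtype', iSup_subtype', ENNReal.iSup_add]
        simp only [ENNReal.add_iSup]
      rw [dist]
      refine iSup_le fun μ => iSup_le fun ν => ?_
      have step : ∀ r s : ℝ≥0, ((r : ℝ≥0∞) < μ.1.toFun U ∨ r = 0) →
          ((s : ℝ≥0∞) < ν.1.toFun V ∨ s = 0) → (r : ℝ≥0∞) + s ≤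
          (⨆ μ ∈ A, μ.toFun U') + (⨆ μ ∈ A, μ.toFun V') := by
        intro r s hr hs
        have ex : ∃ ξ ∈ A, (r : ℝ≥0∞) ≤ ξ.toFun U ∧ (s : ℝ≥0∞) ≤ ξ.toFun V := by
          rcases hr with hr | rfl
          · rcases hs with hs | rfl
            · obtain ⟨ξ, hξ, h1, h2⟩ := hA.2 _ _ (isOpen_above U r) (isOpen_above V s)
                ⟨μ, μ.2, hr⟩ ⟨ν, ν.2, hs⟩
              exact ⟨ξ, hξ, le_of_lt h1, le_of_lt h2⟩
            · exact ⟨μ, μ.2, hr.le, by simp⟩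
          · rcases hs with hs | rfl
            · exact ⟨ν, ν.2, by simp, hs.le⟩
            · exact ⟨μ, μ.2, by simp, by simp⟩
        obtain ⟨ξ, hξ, h1, h2⟩ := ex
        refine (add_le_add h1 h2).trans ((h ξ).trans (add_le_add ?_ ?_))
        · exact le_iSup₂_of_le ξ hξ le_rfl
        · exact le_iSup₂_of_le ξ hξ le_rfl
      have appr : ∀ a : ℝ≥0∞, a = ⨆ r : {r : ℝ≥0 // (r : ℝ≥0∞) < a ∨ r = 0}, (r.1 : ℝ≥0∞) := by
        intro a
        apply le_antisymm
        · refine ENNReal.le_of_forall_nnreal_lt fun r hr => ?_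
          exact le_iSup (fun r : {r : ℝ≥0 // (r : ℝ≥0∞) < a ∨ r = 0} => (r.1 : ℝ≥0∞)) ⟨r, Or.inl hr⟩
        · refine iSup_le ?_
          rintro ⟨r, hr | rfl⟩
          · exact hr.le
          · simp
      rw [appr (μ.1.toFun U), appr (ν.1.toFun V)]
      have : ∀ a : ℝ≥0∞, Nonempty {r : ℝ≥0 // (r : ℝ≥0∞) < a ∨ r = 0} :=
        fun a => ⟨⟨0, Or.inr rfl⟩⟩
      rw [ENNReal.iSup_add]
      refine iSup_le fun r => ?_
      rw [ENNReal.add_iSup]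
      exact iSup_le fun s => step r.1 s.1 r.2 s.2
    intro U V
    exact le_antisymm (main _ _ _ _ fun μ => (μ.modular' U V).le)
      (main _ _ _ _ fun μ => (μ.modular' U V).ge)
  scott' D hD hd := by
    simp only [fun μ : ContVal X => μ.scott' D hD hd]
    rw [iSup₂_comm]

theorem lt_supr_iff (A : Set (ContVal X)) (hA : IsIrreducible A) (U : Opens X) (r : ℝ≥0∞) :
    r < (supr A hA).toFun U ↔ ∃ μ ∈ A, r < μ.toFun U := by
  simp [supr, lt_iSup_iff]

/-- An open set contains the supremum of an irreducible set iff it meets that set. -/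
theorem supr_mem_open {A : Set (ContVal X)} (hA : IsIrreducible A) {s : Set (ContVal X)}
    (hs : IsOpen s) : supr A hA ∈ s ↔ (A ∩ s).Nonempty := by
  induction hs with
  | basic s hs =>
    obtain ⟨U, r, rfl⟩ := hs
    exact lt_supr_iff A hA U r
  | univ => simpa using hA.1
  | inter s t h1 h2 ih1 ih2 =>
    constructor
    · rintro ⟨hs, ht⟩
      exact hA.2 s t h1 h2 (ih1.1 hs) (ih2.1 ht)
    · rintro ⟨μ, hμ, hs, ht⟩
      exact ⟨ih1.2 ⟨μ, hμ, hs⟩, ih2.2 ⟨μ, hμ, ht⟩⟩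
  | sUnion S _ ih =>
    constructor
    · rintro ⟨s, hs, hm⟩
      obtain ⟨μ, hμ, h⟩ := (ih s hs).1 hm
      exact ⟨μ, hμ, s, hs, h⟩
    · rintro ⟨μ, hμ, s, hs, h⟩
      exact ⟨s, hs, (ih s hs).2 ⟨μ, hμ, h⟩⟩

instance : QuasiSober (ContVal X) := by
  refine ⟨fun {S} hS hSc => ⟨supr S hS, ?_⟩⟩
  rw [IsGenericPoint]
  apply Subset.antisymm
  · refine hSc.closure_subset_iff.2 (singleton_subset_iff.2 ?_)
    by_contra h
    obtain ⟨μ, hμ, hμ'⟩ := (supr_mem_open hS hSc.isOpen_compl).1 h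
    exact hμ' hμ
  · intro μ hμ
    refine (specializes_iff_mem_closure.1 (specializes_of_le fun U => ?_))
    exact le_iSup₂_of_le (f := fun (μ : ContVal X) (_ : μ ∈ S) => μ.toFun U) μ hμ le_rfl

theorem continuous_of_above {Z : Type*} [TopologicalSpace Z] {f : Z → ContVal X}
    (h : ∀ U r, IsOpen {z | (r : ℝ≥0∞) < (f z).toFun U}) : Continuous f := by
  refine continuous_generateFrom_iff.2 ?_
  rintro _ ⟨U, r, rfl⟩
  exact h U r

theorem lowerSemicontinuous_apply (U : Opens X) :
    LowerSemicontinuous fun μ : ContVal X => μ.toFun U := by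
  rw [lowerSemicontinuous_iff_isOpen_preimage]
  intro a
  rcases eq_or_ne a ⊤ with rfl | ha
  · simp
  · lift a to ℝ≥0 using ha
    exact isOpen_above U a

theorem continuous_const_add (ν : ContVal X) : Continuous fun μ : ContVal X => ν + μ := by
  refine continuous_of_above fun U r => ?_
  have : LowerSemicontinuous fun μ : ContVal X => ν.toFun U + μ.toFun U :=
    lowerSemicontinuous_const.add (lowerSemicontinuous_apply U)
  exact lowerSemicontinuous_iff_isOpen_preimage.1 this r

theorem continuous_const_smul (c : ℝ≥0) : Continuous fun μ : ContVal X => c • μ := by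
  refine continuous_of_above fun U r => ?_
  have h : LowerSemicontinuous fun μ : ContVal X => (c : ℝ≥0∞) * μ.toFun U :=
    (ENNReal.continuous_const_mul ENNReal.coe_ne_top).comp_lowerSemicontinuous
      (lowerSemicontinuous_apply U) (fun a b hab => mul_le_mul_right hab _)
  exact lowerSemicontinuous_iff_isOpen_preimage.1 h r

open Classical in
/-- The Dirac mass at `x`. -/
noncomputable def dirac (x : X) : ContVal X where
  toFun U := if x ∈ U then 1 else 0
  strict' := by simp
  mono' U V h := by
    by_cases hx : x ∈ U
    · simp [hx, h hx]
    · simp [hx]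
  modular' U V := by
    by_cases hU : x ∈ U <;> by_cases hV : x ∈ V <;> simp [hU, hV]
  scott' D hD hd := by
    by_cases hx : ∃ U ∈ D, x ∈ U
    · obtain ⟨U, hU, hxU⟩ := hx
      rw [if_pos (Opens.mem_sSup.2 ⟨U, hU, hxU⟩)]
      apply le_antisymm
      · exact le_iSup₂_of_le U hU (by simp [hxU])
      · exact iSup₂_le fun V _ => by split_ifs <;> simp
    · rw [if_neg (fun h => hx (Opens.mem_sSup.1 h))]
      symm
      simp only [ENNReal.iSup_eq_zero]
      intro U hU
      exact if_neg fun h => hx ⟨U, hU, h⟩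

theorem continuous_dirac : Continuous (dirac : X → ContVal X) := by
  refine continuous_of_above fun U r => ?_
  by_cases hr : (r : ℝ≥0∞) < 1
  · convert U.isOpen using 1
    ext x
    by_cases hx : x ∈ U <;> simp [dirac, hx, hr]
  · convert isOpen_empty using 1
    ext x
    by_cases hx : x ∈ U <;> simp_all [dirac]

end ContVal

/-! ### Simple valuations -/

/-- The subcone of simple valuations: the finite linear combinations, with coefficients in `ℝ≥0`,
of Dirac masses. -/
noncomputable def simpleVal (X : Type u) [TopologicalSpace X] : Submodule ℝ≥0 (ContVal X) :=
  Submodule.span ℝ≥0 (range ContVal.dirac)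

/-- The space `V_s X` of simple valuations, a subspace and a subcone of the space of continuous
valuations with the weak topology. -/
abbrev Vs (X : Type u) [TopologicalSpace X] : Type u := simpleVal X

/-- The unit `δˢ` of `V_s`, as a continuous map. -/
noncomputable def diracS (X : Type u) [TopologicalSpace X] : C(X, Vs X) where
  toFun x := ⟨ContVal.dirac x, Submodule.subset_span ⟨x, rfl⟩⟩
  continuous_toFun := ContVal.continuous_dirac.subtype_mk _

/-- `α : V_s C → C` is the structure map of the `V_s`-algebra at the cone `C`: it is the linear
barycentre map, and it satisfies the unit law `α ∘ δˢ = id` and the associativity law `α ∘ V_s α = α ∘ βˢ` of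
an Eilenberg–Moore algebra (the latter evaluated at `∑ i, r i • δ_{μ i}`, using
`V_s α (∑ i, r i • δ_{μ i}) = ∑ i, r i • δ_{α (μ i)}` and
`βˢ (∑ i, r i • δ_{μ i}) = ∑ i, r i • μ i`). -/
structure IsStructureMap {C : Type u} [TopologicalSpace C] [AddCommMonoid C] [Module ℝ≥0 C]
    (α : C(Vs C, C)) : Prop where
  linear : IsLinearMap ℝ≥0 α
  barycentre : ∀ (n : ℕ) (r : Fin n → ℝ≥0) (x : Fin n → C),
    α (∑ i, r i • diracS C (x i)) = ∑ i, r i • x i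
  unit_law : ∀ x : C, α (diracS C x) = x
  assoc_law : ∀ (n : ℕ) (r : Fin n → ℝ≥0) (μ : Fin n → Vs C),
    α (∑ i, r i • diracS C (α (μ i))) = α (∑ i, r i • μ i)

/-! ### The completion of the space of simple valuations -/

namespace KCategory

variable (𝒦 : KCategory.{u}) (X : Type u) [TopologicalSpace X]

/-- `V_𝒦 X`: the smallest `𝒦`-subspace of the space of continuous valuations that contains the
simple valuations; it is a subcone. -/
noncomputable def VK : Submodule ℝ≥0 (ContVal X) where
  carrier := 𝒦.cl (simpleVal X : Set (ContVal X))
  zero_mem' := 𝒦.subset_cl _ (simpleVal X).zero_mem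
  smul_mem' := by
    intro c μ hμ
    exact 𝒦.mapsTo_cl (ContVal.continuous_const_smul c) (A := (simpleVal X : Set (ContVal X)))
      (fun s hs => 𝒦.subset_cl _ ((simpleVal X).smul_mem c hs)) hμ
  add_mem' := by
    intro μ ν hμ hν
    have h1 : ∀ s ∈ (simpleVal X : Set (ContVal X)), ∀ ξ ∈ 𝒦.cl (simpleVal X : Set (ContVal X)),
        s + ξ ∈ 𝒦.cl (simpleVal X : Set (ContVal X)) := fun s hs ξ hξ =>
      𝒦.mapsTo_cl (ContVal.continuous_const_add s) (A := (simpleVal X : Set (ContVal X)))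
        (fun t ht => 𝒦.subset_cl _ ((simpleVal X).add_mem hs ht)) hξ
    exact 𝒦.mapsTo_cl (ContVal.continuous_const_add μ) (A := (simpleVal X : Set (ContVal X)))
      (fun t ht => by
        change μ + t ∈ _
        rw [add_comm]
        exact h1 t ht μ hμ) hν

variable {X}

/-- The image of an irreducible set of simple valuations in the continuous valuations. -/
theorem irred_image (A : Sobrification (Vs X)) :
    IsIrreducible ((Subtype.val : Vs X → ContVal X) '' A.carrier) :=
  A.irred.image _ continuous_subtype_val.continuousOn

/-- The continuous map from the sobrification of `V_s X` to the continuous valuations which extends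
the inclusion of `V_s X`: it takes an irreducible closed set to its pointwise supremum. -/
noncomputable def toContVal (A : Sobrification (Vs X)) : ContVal X :=
  ContVal.supr (Subtype.val '' A.carrier) (irred_image A)

theorem toContVal_mem_open (A : Sobrification (Vs X)) (s : Opens (ContVal X)) :
    toContVal A ∈ s ↔
      A ∈ Sobrification.hit (Opens.comap ⟨Subtype.val, continuous_subtype_val⟩ s) := by
  refine (ContVal.supr_mem_open (irred_image A) s.isOpen).trans ?_
  constructor
  · rintro ⟨_, ⟨μ, hμ, rfl⟩, h⟩
    exact ⟨μ, hμ, h⟩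
  · rintro ⟨μ, hμ, h⟩
    exact ⟨μ, ⟨μ, hμ, rfl⟩, h⟩

theorem isEmbedding_toContVal : IsEmbedding (toContVal : Sobrification (Vs X) → ContVal X) := by
  refine IsInducing.isEmbedding ⟨?_⟩
  ext t
  rw [isOpen_induced_iff]
  constructor
  · intro ht
    obtain ⟨U, rfl⟩ := Sobrification.isOpen_iff.1 ht
    obtain ⟨s, hs, hsU⟩ := isOpen_induced_iff.1 U.isOpen
    refine ⟨s, hs, ?_⟩
    ext A
    refine (toContVal_mem_open A ⟨s, hs⟩).trans ?_
    have : Opens.comap ⟨Subtype.val, continuous_subtype_val⟩ (⟨s, hs⟩ : Opens (ContVal X)) = U :=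
      Opens.ext hsU
    rw [this]
  · rintro ⟨s, hs, rfl⟩
    refine Sobrification.isOpen_iff.2
      ⟨Opens.comap ⟨Subtype.val, continuous_subtype_val⟩ ⟨s, hs⟩, ?_⟩
    ext A
    exact toContVal_mem_open A ⟨s, hs⟩

theorem toContVal_unit (μ : Vs X) : toContVal (Sobrification.unit μ) = μ := by
  have : Inseparable (toContVal (Sobrification.unit μ)) (μ : ContVal X) := by
    rw [inseparable_iff_forall_isOpen]
    intro s hs
    exact (toContVal_mem_open _ ⟨s, hs⟩).trans (Sobrification.unit_mem_hit _ _)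
  exact this.eq

/-- `toContVal`, restricted to the completion of `V_s X`. -/
noncomputable def kcToContVal (A : 𝒦.Kc (Vs X)) : ContVal X := toContVal A.1

theorem isEmbedding_kcToContVal : IsEmbedding (𝒦.kcToContVal : 𝒦.Kc (Vs X) → ContVal X) :=
  isEmbedding_toContVal.comp IsEmbedding.subtypeVal

theorem range_kcToContVal :
    range (𝒦.kcToContVal : 𝒦.Kc (Vs X) → ContVal X) = (𝒦.VK X : Set (ContVal X)) := by
  apply Subset.antisymm
  · rintro _ ⟨A, rfl⟩
    refine 𝒦.mapsTo_cl isEmbedding_toContVal.continuous ?_ A.2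
    rintro _ ⟨μ, rfl⟩
    rw [toContVal_unit]
    exact 𝒦.subset_cl _ μ.2
  · refine 𝒦.cl_subset ?_ ?_
    · intro μ hμ
      exact ⟨𝒦.η (⟨μ, hμ⟩ : Vs X), toContVal_unit _⟩
    · exact 𝒦.of_homeomorph _ _ 𝒦.isEmbedding_kcToContVal.toHomeomorph (𝒦.isKSpace_cl _)

/-- The canonical homeomorphism between the completion of `V_s X` and `V_𝒦 X`, under which the
former carries the pointwise cone structure of the latter. -/
noncomputable def vkHomeo : 𝒦.Kc (Vs X) ≃ₜ 𝒦.VK X :=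
  𝒦.isEmbedding_kcToContVal.toHomeomorph.trans (Homeomorph.setCongr 𝒦.range_kcToContVal)

/-- The identification extends the inclusion of the simple valuations. -/
theorem vkHomeo_η (μ : Vs X) : (𝒦.vkHomeo (𝒦.η μ) : ContVal X) = μ := toContVal_unit μ

/-- Addition on the completion of `V_s X`. -/
noncomputable def vkAdd (a b : 𝒦.Kc (Vs X)) : 𝒦.Kc (Vs X) :=
  𝒦.vkHomeo.symm (𝒦.vkHomeo a + 𝒦.vkHomeo b)

/-- Scalar multiplication on the completion of `V_s X`. -/
noncomputable def vkSMul (r : ℝ≥0) (a : 𝒦.Kc (Vs X)) : 𝒦.Kc (Vs X) :=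
  𝒦.vkHomeo.symm (r • 𝒦.vkHomeo a)

end KCategory

/-! ### A fractional marriage theorem -/

/-! The crux is that the barycentre map `∑ rᵢ δ_{xᵢ} ↦ ∑ rᵢ xᵢ` is well defined and continuous; both
follow from `exists_isOpen_barycentre_mem`. Suppose `∑ rᵢ xᵢ` lies in an open `U`. By joint
continuity, and since in the Scott topology each `rᵢ > 0` can be lowered slightly to `sᵢ`, there are
convex neighbourhoods `Aᵢ` of `xᵢ` such that `∑ tᵢ bᵢ ∈ U` whenever `tᵢ ≥ sᵢ` and `bᵢ ∈ Aᵢ`. The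
weakly open condition imposed on a simple valuation `ν` is `ν(⋃_{i ∈ S} int Aᵢ) > ∑_{i ∈ S} sᵢ` for
all nonempty `S`. This is a strict Hall condition, so `exists_transport_of_sum_lt` distributes part
of the mass of `ν` so that each `Aᵢ` receives at least `sᵢ`. By convexity the mass sent to `Aᵢ` acts
as a multiple of one point of `Aᵢ`, and the undistributed mass does no harm because open sets of a
topological cone absorb addition. Two formal sums of the same valuation thus have topologically
indistinguishable barycentres, equal by `T₀`; linear independence of Dirac masses is never used.

For the completion, the image of `η` is dense in the strong sense that an open set of `Kc X` is
determined by its trace on `X`. Hence continuous maps into a `T₀` space that agree on `η` agree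
everywhere (`eq_of_η`, `eq_of_η₂`). The induced operations are continuous because those of the cone
of valuations are, and on the image of `η` they are the operations of `C`, so the cone laws extend.

Finally, `Kc(α) ∘ Kc(δ) = id` and `Kc(α)` is linear. So `Kc C` is a linear retract of a subcone of
the locally convex cone of valuations, which yields weak local convexity. -/

/-- A supply-demand theorem for real capacities, under a strict version of Hall's condition. -/
theorem exists_transport_of_sum_lt {ι κ : Type*} [Fintype ι] [Fintype κ] (R : ι → κ → Prop)
    [∀ S : Finset ι, DecidablePred fun j => ∃ i ∈ S, R i j]
    (s : ι → ℝ≥0) (t : κ → ℝ≥0)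
    (h : ∀ S : Finset ι, S.Nonempty →
      ∑ i ∈ S, s i < ∑ j ∈ Finset.univ.filter (fun j => ∃ i ∈ S, R i j), t j) :
    ∃ w : ι → κ → ℝ≥0, (∀ i, s i ≤ ∑ j, w i j) ∧ (∀ j, ∑ i, w i j ≤ t j) ∧
      ∀ i j, w i j ≠ 0 → R i j := by
  classical
  -- Rational approximation with common denominator `n`: demands are rounded up and supplies down,
  -- so an integral solution still solves the real problem. The finitely many strict inequalities
  -- survive for large `n`.
  have hev : ∀ᶠ n : ℕ in Filter.atTop, ∀ S : Finset ι, S.Nonempty →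
      ∑ i ∈ S, (⌈(s i : ℝ) * n⌉₊ : ℝ) / n <
        ∑ j ∈ Finset.univ.filter (fun j => ∃ i ∈ S, R i j), (⌊(t j : ℝ) * n⌋₊ : ℝ) / n := by
    refine Filter.eventually_all.2 fun S => ?_
    by_cases hS : S.Nonempty
    · simp only [hS, true_imp_iff]
      refine Filter.Tendsto.eventually_lt
        (tendsto_finsetSum _ fun i _ => (tendsto_nat_ceil_mul_div_atTop (s i).2).comp
          tendsto_natCast_atTop_atTop)
        (tendsto_finsetSum _ fun j _ => (tendsto_nat_floor_mul_div_atTop (t j).2).comp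
          tendsto_natCast_atTop_atTop) ?_
      have hS' := NNReal.coe_lt_coe.2 (h S hS)
      rw [NNReal.coe_sum, NNReal.coe_sum] at hS'
      exact hS'
    · simp [hS]
  obtain ⟨n, hn, hn0⟩ := (hev.and (Filter.eventually_gt_atTop 0)).exists
  have hn0' : (0 : ℝ) < n := by exact_mod_cast hn0
  set p : ι → ℕ := fun i => ⌈(s i : ℝ) * n⌉₊
  set m : κ → ℕ := fun j => ⌊(t j : ℝ) * n⌋₊
  have hpm : ∀ S : Finset ι, ∑ i ∈ S, p i ≤
      ∑ j ∈ Finset.univ.filter (fun j => ∃ i ∈ S, R i j), m j := by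
    intro S
    rcases S.eq_empty_or_nonempty with rfl | hS
    · simp
    · have := hn S hS
      rw [← Finset.sum_div, ← Finset.sum_div, div_lt_div_iff_of_pos_right hn0'] at this
      exact_mod_cast this.le
  -- Hall's theorem for `p i` copies of `i` and `m j` copies of `j`. Replacing a set of copies by
  -- the full fibres over its projection leaves its neighbours unchanged, so `hpm` suffices.
  obtain ⟨f, hf, hfR⟩ := (Fintype.all_card_le_filter_rel_iff_exists_injective
    (fun (a : Σ i, Fin (p i)) (b : Σ j, Fin (m j)) => R a.1 b.1)).1 (by
      intro A
      calc A.card ≤ ((A.image Sigma.fst).sigma fun i => (Finset.univ : Finset (Fin (p i)))).card :=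
            Finset.card_le_card fun a ha => by
              simp only [Finset.mem_sigma, Finset.mem_univ, and_true]
              exact Finset.mem_image_of_mem _ ha
        _ ≤ ((Finset.univ.filter (fun j => ∃ i ∈ A.image Sigma.fst, R i j)).sigma
              fun j => (Finset.univ : Finset (Fin (m j)))).card := by
            simpa only [Finset.card_sigma, Finset.card_univ, Fintype.card_fin] using hpm _
        _ ≤ _ := Finset.card_le_card fun b hb => by
            simp only [Finset.mem_sigma, Finset.mem_filter, Finset.mem_univ, true_and, and_true,
              Finset.mem_image] at hb ⊢
            obtain ⟨_, ⟨a, ha, rfl⟩, hR⟩ := hb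
            exact ⟨a, ha, hR⟩)
  -- The flow from `i` to `j` counts the copies of `i` matched to copies of `j`, in units of `1 /
  -- n`.
  refine ⟨fun i j => ((Finset.univ.filter fun k : Fin (p i) => (f ⟨i, k⟩).1 = j).card : ℝ≥0) / n,
    fun i => ?_, fun j => ?_, fun i j hij => ?_⟩
  · rw [← Finset.sum_div, ← Nat.cast_sum,
      ← Finset.card_eq_sum_card_fiberwise (f := fun k : Fin (p i) => (f ⟨i, k⟩).1)
        (fun _ _ => Finset.mem_coe.2 (Finset.mem_univ _)),
      Finset.card_univ, Fintype.card_fin, ← NNReal.coe_le_coe]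
    push_cast
    rw [le_div_iff₀ hn0']
    exact Nat.le_ceil _
  · rw [← Finset.sum_div, ← Nat.cast_sum, ← NNReal.coe_le_coe]
    push_cast
    rw [div_le_iff₀ hn0']
    refine le_trans ?_ (Nat.floor_le (mul_nonneg (t j).2 hn0'.le))
    norm_cast
    rw [← Finset.card_sigma]
    calc _ ≤ (({j} : Finset κ).sigma fun j => (Finset.univ : Finset (Fin (m j)))).card := by
          refine Finset.card_le_card_of_injOn f (fun a ha => ?_) hf.injOn
          simpa using ha
      _ = m j := by simp
  · have : (Finset.univ.filter fun k : Fin (p i) => (f ⟨i, k⟩).1 = j).Nonempty := by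
      rw [Finset.nonempty_iff_ne_empty]
      intro h0
      simp [h0] at hij
    obtain ⟨k, hk⟩ := this
    rw [← (Finset.mem_filter.1 hk).2]
    exact hfR ⟨i, k⟩

/-! ### Topological cones -/

/-- A finite combination of points of a convex set is a multiple of a point of the set. -/
theorem Convex.exists_sum_smul_eq {C κ : Type*} [AddCommMonoid C] [Module ℝ≥0 C] {A : Set C}
    (hA : Convex ℝ≥0 A) (hne : A.Nonempty) (T : Finset κ) (w : κ → ℝ≥0) (y : κ → C)
    (h : ∀ j ∈ T, w j ≠ 0 → y j ∈ A) : ∃ a ∈ A, ∑ j ∈ T, w j • y j = (∑ j ∈ T, w j) • a := by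
  classical
  induction T using Finset.induction_on with
  | empty => exact ⟨hne.some, hne.some_mem, by simp⟩
  | insert j T hj ih =>
    obtain ⟨a, ha, hsum⟩ := ih fun k hk => h k (Finset.mem_insert_of_mem hk)
    rw [Finset.sum_insert hj, Finset.sum_insert hj, hsum]
    -- A point of weight zero need not lie in `A`, but contributes nothing; otherwise the total
    -- weight is invertible and can be normalised.
    by_cases hw : w j = 0
    · exact ⟨a, ha, by simp [hw]⟩
    set W := ∑ k ∈ T, w k
    have hpos : w j + W ≠ 0 := fun h0 => hw (add_eq_zero.1 h0).1
    refine ⟨(w j / (w j + W)) • y j + (W / (w j + W)) • a,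
      hA (h j (Finset.mem_insert_self _ _) hw) ha zero_le zero_le ?_, ?_⟩
    · rw [← add_div, div_self hpos]
    · rw [smul_add, smul_smul, smul_smul, mul_div_cancel₀ _ hpos, mul_div_cancel₀ _ hpos]

/-- A positive `r` is the supremum of the directed set `Iio r`, and Scott open sets are inaccessible
by such suprema. Positivity makes `Iio r` nonempty. -/
theorem WithScott.exists_lt_toScott_mem {u : Set (WithScott ℝ≥0)} (hu : IsOpen u) {r : ℝ≥0}
    (hr : 0 < r) (hru : WithScott.toScott r ∈ u) : ∃ s < r, WithScott.toScott s ∈ u := by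
  have hlub : IsLUB (Iio r) r := isLUB_Iio
  have hacc := ((IsScott.isOpen_iff_isUpperSet_and_dirSupInaccOn (D := univ)).1 hu).2
  obtain ⟨s, hs, hsu⟩ := @hacc ( WithScott.ofScott ⁻¹' Iio r) (mem_univ _) ⟨(0 : ℝ≥0), hr⟩
    (fun a ha b hb => (le_total (WithScott.ofScott a) (WithScott.ofScott b)).elim
      (fun h => ⟨b, hb, h, le_rfl⟩) (fun h => ⟨a, ha, le_rfl, h⟩)) (WithScott.toScott r)
    hlub hru
  exact ⟨s, hs, hsu⟩

theorem WithScott.isOpen_preimage_Ioi (a : ℝ≥0) :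
    IsOpen (WithScott.ofScott ⁻¹' Ioi a : Set (WithScott ℝ≥0)) := by
  refine (IsScott.isOpen_iff_isUpperSet_and_dirSupInaccOn (D := univ)).2 ⟨?_, ?_⟩
  · intro x y hxy hx
    exact lt_of_lt_of_le (show a < WithScott.ofScott x from hx) hxy
  · intro d _ _ _ b hb hab
    obtain ⟨c, hc, hac⟩ := (lt_isLUB_iff (α := ℝ≥0) hb).1 hab
    exact ⟨c, hc, hac⟩

namespace IsTopologicalCone

variable {C : Type*} [TopologicalSpace C] [AddCommMonoid C] [Module ℝ≥0 C]

/-- Open sets of a topological cone are stable under addition of arbitrary elements. -/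
theorem add_mem_of_isOpen (hC : IsTopologicalCone C) {U : Set C} (hU : IsOpen U) {x : C}
    (hx : x ∈ U) (y : C) : x + y ∈ U := by
  -- Scott open sets are upper sets, so the preimage of `U` under `r ↦ x + r • y` contains `1` as
  -- soon as it contains `0`.
  have hc : Continuous fun r : WithScott ℝ≥0 => x + WithScott.ofScott r • y :=
    hC.continuous_add.comp (continuous_const.prodMk
      (hC.continuous_smul.comp (continuous_id.prodMk continuous_const)))
  have h0 : (WithScott.toScott 0 : WithScott ℝ≥0) ∈
      (fun r : WithScott ℝ≥0 => x + WithScott.ofScott r • y) ⁻¹' U := by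
    simpa using hx
  have := IsScott.isUpperSet_of_isOpen (D := univ) (hU.preimage hc)
    (show (WithScott.toScott 0 : WithScott ℝ≥0) ≤ WithScott.toScott 1 from zero_le_one' ℝ≥0) h0
  simpa using this

end IsTopologicalCone

/-! ### Barycentres of simple valuations -/

namespace ContVal

variable {X : Type u} [TopologicalSpace X]

/-- The simple valuation given by a formal combination of points. -/
noncomputable def ofFinsupp (X : Type u) [TopologicalSpace X] : (X →₀ ℝ≥0) →ₗ[ℝ≥0] ContVal X :=
  Finsupp.linearCombination ℝ≥0 dirac

theorem sum_apply {ι : Type*} (T : Finset ι) (μ : ι → ContVal X) (U : Opens X) :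
    (∑ i ∈ T, μ i).toFun U = ∑ i ∈ T, (μ i).toFun U :=
  map_sum (⟨⟨fun μ => μ.toFun U, rfl⟩, fun _ _ => rfl⟩ : ContVal X →+ ℝ≥0∞) μ T

-- The value is a finite sum in `ℝ≥0` over the subtype of the support, which is the shape of the
-- supply side in `exists_transport_of_sum_lt`.
open Classical in
theorem ofFinsupp_apply (f : X →₀ ℝ≥0) (U : Opens X) :
    (ofFinsupp X f).toFun U = ((∑ x : f.support with x.1 ∈ U, f x : ℝ≥0) : ℝ≥0∞) := by
  rw [ofFinsupp, Finsupp.linearCombination_apply, Finsupp.sum, sum_apply, Finset.sum_filter,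
    ← Finset.sum_coe_sort f.support]
  push_cast
  refine Finset.sum_congr rfl fun x _ => ?_
  rw [smul_apply]
  by_cases h : x.1 ∈ U <;> simp [dirac, h]

end ContVal

variable {C : Type u} [TopologicalSpace C] [AddCommMonoid C] [Module ℝ≥0 C]

/-- If the barycentre of a formal combination lies in an open set, so do the barycentres of all
combinations whose valuations are weakly close to that of the given one. -/
theorem IsWeaklyLocallyConvex.exists_isOpen_barycentre_mem (hC : IsTopologicalCone C)
    (hw : IsWeaklyLocallyConvex C) (f : C →₀ ℝ≥0) {U : Set C} (hU : IsOpen U)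
    (hf : Finsupp.linearCombination ℝ≥0 id f ∈ U) :
    ∃ W : Set (ContVal C), IsOpen W ∧ ContVal.ofFinsupp C f ∈ W ∧
      ∀ g : C →₀ ℝ≥0, ContVal.ofFinsupp C g ∈ W → Finsupp.linearCombination ℝ≥0 id g ∈ U := by
  classical
  have : ContinuousAdd C := ⟨hC.continuous_add⟩
  have hbary : ∀ g : C →₀ ℝ≥0, Finsupp.linearCombination ℝ≥0 id g =
      ∑ j : g.support, g j • (j : C) := fun g => by
    rw [Finsupp.linearCombination_apply, Finsupp.sum]
    exact (Finset.sum_coe_sort g.support fun x => g x • x).symm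
  let Φ : (f.support → WithScott ℝ≥0 × C) → C :=
    fun p => ∑ i, WithScott.ofScott (p i).1 • (p i).2
  have hΦ : Continuous Φ :=
    continuous_finsetSum _ fun i _ => hC.continuous_smul.comp (continuous_apply i)
  have hmem : (fun i : f.support => (WithScott.toScott (f i), (i : C))) ∈ Φ ⁻¹' U := by
    rw [hbary] at hf
    exact hf
  obtain ⟨u, hu, huU⟩ := isOpen_pi_iff'.1 (hU.preimage hΦ) _ hmem
  choose v a hv ha hvm ham hva using fun i => isOpen_prod_iff.1 (hu i).1 _ _ (hu i).2
  -- The gap `s i < f i` is what makes the conditions defining the weak neighbourhood strict at `f`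
  -- itself.
  choose s hs hsv using fun i : f.support => WithScott.exists_lt_toScott_mem (hv i)
    (pos_iff_ne_zero.2 (Finsupp.mem_support_iff.1 i.2)) (hvm i)
  choose A hA hAa hAc using fun i : f.support => hw i (a i) (ha i) (ham i)
  let O : f.support → Opens C := fun i => ⟨interior (A i), isOpen_interior⟩
  -- One subbasic condition for each nonempty `S`: together they are the strict Hall condition for
  -- demands `s i` and target sets `O i`.
  refine ⟨⋂ S : {S : Finset f.support // S.Nonempty},
    ContVal.above (⨆ i ∈ S.1, O i) (∑ i ∈ S.1, s i),
    isOpen_iInter_of_finite fun S => ContVal.isOpen_above _ _, ?_, ?_⟩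
  · refine mem_iInter.2 fun S => ?_
    change ((_ : ℝ≥0) : ℝ≥0∞) < _
    rw [ContVal.ofFinsupp_apply, ENNReal.coe_lt_coe]
    refine (Finset.sum_lt_sum_of_nonempty S.2 fun i _ => hs i).trans_le
      (Finset.sum_le_sum_of_subset fun i hi => ?_)
    simp only [Finset.mem_filter, Finset.mem_univ, true_and, Opens.mem_iSup]
    exact ⟨i, hi, mem_interior_iff_mem_nhds.2 (hA i)⟩
  · intro g hg
    obtain ⟨w, hw1, hw2, hw3⟩ := exists_transport_of_sum_lt
      (fun (i : f.support) (j : g.support) => j.1 ∈ O i) s (fun j => g j) (fun S hS => by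
        have := mem_iInter.1 hg ⟨S, hS⟩
        change ((_ : ℝ≥0) : ℝ≥0∞) < _ at this
        rw [ContVal.ofFinsupp_apply, ENNReal.coe_lt_coe] at this
        simpa only [Opens.mem_iSup, exists_prop] using this)
    choose b hb hbs using fun i => (hAc i).exists_sum_smul_eq ⟨i, mem_of_mem_nhds (hA i)⟩
      Finset.univ (w i) (fun j : g.support => (j : C))
      (fun j _ hij => interior_subset (hw3 i j hij))
    -- The mass received by `i` may exceed `s i`, but `v i` is an upper set, so it remains in `v i`.
    have hmain : ∑ i, (∑ j, w i j) • b i ∈ U := by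
      refine huU (a := fun i => (WithScott.toScott (∑ j, w i j), b i))
        fun i _ => hva i ⟨?_, hAa i (hb i)⟩
      exact IsScott.isUpperSet_of_isOpen (D := univ) (hv i) (hw1 i) (hsv i)
    -- The truncated subtraction is a genuine remainder, since `hw2` bounds the mass taken from `j`
    -- by `g j`.
    have hsplit : Finsupp.linearCombination ℝ≥0 id g =
        ∑ i, (∑ j, w i j) • b i + ∑ j : g.support, (g j - ∑ i, w i j) • (j : C) := by
      simp only [← hbs]
      rw [hbary, Finset.sum_comm, ← Finset.sum_add_distrib]
      refine Finset.sum_congr rfl fun j _ => ?_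
      rw [← Finset.sum_smul, ← add_smul, add_tsub_cancel_of_le (hw2 j)]
    rw [hsplit]
    exact hC.add_mem_of_isOpen hU hmain _

theorem range_ofFinsupp (X : Type u) [TopologicalSpace X] :
    LinearMap.range (ContVal.ofFinsupp X) = simpleVal X :=
  Finsupp.range_linearCombination ℝ≥0

/-- The barycentre map on simple valuations over a weakly locally convex topological cone. -/
theorem IsWeaklyLocallyConvex.exists_barycentre_map (hC : IsTopologicalCone C)
    (hw : IsWeaklyLocallyConvex C) :
    ∃ α : C(Vs C, C), ∀ (f : C →₀ ℝ≥0) (μ : Vs C), ContVal.ofFinsupp C f = μ →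
      α μ = Finsupp.linearCombination ℝ≥0 id f := by
  have := hC.t0
  have hsurj : ∀ μ : Vs C, ∃ f, ContVal.ofFinsupp C f = μ := fun μ =>
    LinearMap.mem_range.1 ((range_ofFinsupp C).ge μ.2)
  choose φ hφ using hsurj
  -- Equal valuations lie in the same weakly open sets, so each barycentre specialises to the other;
  -- `T₀` then makes the choice of representative irrelevant.
  have hspec : ∀ f g : C →₀ ℝ≥0, ContVal.ofFinsupp C f = ContVal.ofFinsupp C g →
      Finsupp.linearCombination ℝ≥0 id f ⤳ Finsupp.linearCombination ℝ≥0 (id : C → C) g := by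
    intro f g hfg
    rw [specializes_iff_forall_open]
    intro U hU hg
    obtain ⟨W, -, hW, hWU⟩ := hw.exists_isOpen_barycentre_mem hC g hU hg
    exact hWU f (hfg ▸ hW)
  refine ⟨⟨fun μ => Finsupp.linearCombination ℝ≥0 id (φ μ), ?_⟩, fun f μ hf => ?_⟩
  · refine continuous_def.2 fun U hU => isOpen_iff_mem_nhds.2 fun μ hμ => ?_
    obtain ⟨W, hWo, hW, hWU⟩ := hw.exists_isOpen_barycentre_mem hC (φ μ) hU hμ
    refine Filter.mem_of_superset ((hWo.preimage continuous_subtype_val).mem_nhds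
      (show (μ : ContVal C) ∈ W from hφ μ ▸ hW)) fun ν hν => hWU _ ?_
    rw [hφ ν]
    exact hν
  · have h := (hφ μ).trans hf.symm
    exact ((hspec _ _ h).antisymm (hspec _ _ h.symm)).eq

theorem ofFinsupp_sum_single {X : Type u} [TopologicalSpace X] {n : ℕ} (r : Fin n → ℝ≥0)
    (x : Fin n → X) : ContVal.ofFinsupp X (∑ i, Finsupp.single (x i) (r i)) =
      ((∑ i, r i • diracS X (x i) : Vs X) : ContVal X) := by
  simp [ContVal.ofFinsupp, diracS]

theorem IsWeaklyLocallyConvex.exists_isStructureMap (hC : IsTopologicalCone C)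
    (hw : IsWeaklyLocallyConvex C) : ∃ α : C(Vs C, C), IsStructureMap α := by
  obtain ⟨α, hα⟩ := hw.exists_barycentre_map hC
  have hsurj : ∀ μ : Vs C, ∃ f, ContVal.ofFinsupp C f = μ := fun μ =>
    LinearMap.mem_range.1 ((range_ofFinsupp C).ge μ.2)
  have hlin : IsLinearMap ℝ≥0 α := by
    refine ⟨fun μ ν => ?_, fun r μ => ?_⟩
    · obtain ⟨f, hf⟩ := hsurj μ
      obtain ⟨g, hg⟩ := hsurj ν
      rw [hα f μ hf, hα g ν hg, hα (f + g) (μ + ν) (by rw [map_add, hf, hg]; rfl), map_add]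
    · obtain ⟨f, hf⟩ := hsurj μ
      rw [hα f μ hf, hα (r • f) (r • μ) (by rw [map_smul, hf]; rfl), map_smul]
  have hbary : ∀ (n : ℕ) (r : Fin n → ℝ≥0) (x : Fin n → C),
      α (∑ i, r i • diracS C (x i)) = ∑ i, r i • x i := fun n r x => by
    rw [hα _ _ (ofFinsupp_sum_single r x)]
    simp
  refine ⟨α, hlin, hbary, fun x => ?_, fun n r μ => ?_⟩
  · simpa using hbary 1 (fun _ => 1) (fun _ => x)
  · rw [hbary]
    have := map_sum hlin.mk' (fun i => r i • μ i) Finset.univ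
    simp only [IsLinearMap.mk'_apply] at this
    rw [this]
    exact Finset.sum_congr rfl fun i _ => (hlin.map_smul _ _).symm

/-- Linearity and the unit law suffice, because the Dirac masses span the simple valuations. -/
theorem IsStructureMap.eq {α β : C(Vs C, C)} (hα : IsStructureMap α) (hβ : IsStructureMap β) :
    α = β := by
  ext ⟨μ, hμ⟩
  induction hμ using Submodule.span_induction with
  | mem x hx =>
    obtain ⟨c, rfl⟩ := hx
    exact (hα.unit_law c).trans (hβ.unit_law c).symm
  | zero => exact hα.linear.map_zero.trans hβ.linear.map_zero.symm
  | add x y hx hy h1 h2 =>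
    have e1 := hα.linear.map_add ⟨x, hx⟩ ⟨y, hy⟩
    have e2 := hβ.linear.map_add ⟨x, hx⟩ ⟨y, hy⟩
    exact e1.trans ((congrArg₂ _ h1 h2).trans e2.symm)
  | smul r x hx h =>
    have e1 := hα.linear.map_smul r ⟨x, hx⟩
    have e2 := hβ.linear.map_smul r ⟨x, hx⟩
    exact e1.trans ((congrArg _ h).trans e2.symm)

/-! ### The cone of continuous valuations -/

namespace ContVal

variable {X : Type u} [TopologicalSpace X]

instance : ContinuousAdd (ContVal X) := by
  refine ⟨continuous_of_above fun U r => ?_⟩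
  have h : LowerSemicontinuous fun p : ContVal X × ContVal X => p.1.toFun U + p.2.toFun U :=
    ((lowerSemicontinuous_apply U).comp continuous_fst).add
      ((lowerSemicontinuous_apply U).comp continuous_snd)
  exact lowerSemicontinuous_iff_isOpen_preimage.1 h r

theorem continuous_scott_smul :
    Continuous fun p : WithScott ℝ≥0 × ContVal X => WithScott.ofScott p.1 • p.2 := by
  refine continuous_of_above fun U r => isOpen_iff_forall_mem_open.2 ?_
  rintro ⟨c, μ⟩ hr
  have hr' : ¬ ((WithScott.ofScott c : ℝ≥0) : ℝ≥0∞) * μ.toFun U ≤ r := not_le.2 hr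
  -- A product in `ℝ≥0∞` is bounded by any bound for the products of strictly smaller factors, so
  -- `r` is already exceeded by some `a * b`.
  have : ∃ a : ℝ≥0, a < WithScott.ofScott c ∧ ∃ b : ℝ≥0, (b : ℝ≥0∞) < μ.toFun U ∧
      (r : ℝ≥0∞) < a * b := by
    by_contra! hcon
    refine hr' (ENNReal.mul_le_of_forall_lt fun a ha b hb => ?_)
    lift a to ℝ≥0 using ha.ne_top
    lift b to ℝ≥0 using hb.ne_top
    exact hcon a (ENNReal.coe_lt_coe.1 ha) b hb
  obtain ⟨a, ha, b, hb, hab⟩ := this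
  refine ⟨(WithScott.ofScott ⁻¹' Ioi a) ×ˢ above U b, ?_,
    (WithScott.isOpen_preimage_Ioi a).prod (isOpen_above U b), ha, hb⟩
  rintro ⟨c', μ'⟩ ⟨hc, hμ⟩
  exact hab.trans_le (mul_le_mul' (ENNReal.coe_le_coe.2 (le_of_lt hc)) (le_of_lt hμ))

theorem convex_above (U : Opens X) (r : ℝ≥0) : Convex ℝ≥0 (above U r) := by
  intro μ hμ ν hν a b _ _ hab
  change (r : ℝ≥0∞) < (a : ℝ≥0∞) * μ.toFun U + (b : ℝ≥0∞) * ν.toFun U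
  have hr : (r : ℝ≥0∞) = a * r + b * r := by
    rw [← add_mul, ← ENNReal.coe_add, hab, ENNReal.coe_one, one_mul]
  have mono : ∀ (c : ℝ≥0) (m : ℝ≥0∞), (r : ℝ≥0∞) < m → (c : ℝ≥0∞) * r ≤ c * m :=
    fun c m h => mul_le_mul_right h.le _
  -- Strictness comes from the `μ` term when `a ≠ 0`, and from `ν` when `a = 0`, where `b = 1`.
  by_cases ha : a = 0
  · subst ha
    rw [zero_add] at hab
    simp only [hab, ENNReal.coe_zero, zero_mul, zero_add, ENNReal.coe_one, one_mul]
    exact hν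
  · rw [hr]
    refine ENNReal.add_lt_add_of_lt_of_le (by finiteness) ?_ (mono b _ hν)
    exact (ENNReal.mul_lt_mul_iff_right (by simpa using ha) ENNReal.coe_ne_top).2 hμ

/-- The weak topology is locally convex. -/
theorem exists_isOpen_convex {s : Set (ContVal X)} (hs : IsOpen s) {μ : ContVal X} (hμ : μ ∈ s) :
    ∃ A, IsOpen A ∧ μ ∈ A ∧ A ⊆ s ∧ Convex ℝ≥0 A := by
  induction hs with
  | basic s hs =>
    obtain ⟨U, r, rfl⟩ := hs
    exact ⟨_, isOpen_above U r, hμ, Subset.rfl, convex_above U r⟩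
  | univ => exact ⟨univ, isOpen_univ, hμ, Subset.rfl, convex_univ⟩
  | inter s t _ _ h1 h2 =>
    obtain ⟨A, hA, hμA, hAs, hAc⟩ := h1 hμ.1
    obtain ⟨B, hB, hμB, hBt, hBc⟩ := h2 hμ.2
    exact ⟨A ∩ B, hA.inter hB, ⟨hμA, hμB⟩, inter_subset_inter hAs hBt, hAc.inter hBc⟩
  | sUnion S _ ih =>
    obtain ⟨s, hs, hm⟩ := hμ
    obtain ⟨A, hA, hμA, hAs, hAc⟩ := ih s hs hm
    exact ⟨A, hA, hμA, hAs.trans (subset_sUnion_of_mem hs), hAc⟩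

end ContVal

/-! ### Extension of identities to the completion -/

namespace KCategory

variable (𝒦 : KCategory.{u}) {X Y Z : Type u} [TopologicalSpace X] [TopologicalSpace Y]
  [TopologicalSpace Z]

instance : T0Space (𝒦.Kc X) :=
  inferInstanceAs (T0Space (𝒦.cl (range (Sobrification.unit : X → Sobrification X))))

theorem isKSpace_Kc (X : Type u) [TopologicalSpace X] : 𝒦.IsKSpace (𝒦.Kc X) :=
  𝒦.isKSpace_cl _

theorem continuous_η : Continuous (𝒦.η : X → 𝒦.Kc X) :=
  Sobrification.continuous_unit.subtype_mk _

theorem isOpen_Kc_iff {s : Set (𝒦.Kc X)} :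
    IsOpen s ↔ ∃ U : Opens X, s = {a | a.1 ∈ Sobrification.hit U} := by
  constructor
  · intro hs
    obtain ⟨t, ht, rfl⟩ := isOpen_induced_iff.1 hs
    obtain ⟨U, rfl⟩ := Sobrification.isOpen_iff.1 ht
    exact ⟨U, rfl⟩
  · rintro ⟨U, rfl⟩
    exact isOpen_induced_iff.2 ⟨_, Sobrification.isOpen_hit U, rfl⟩

theorem isEmbedding_η [T0Space X] : IsEmbedding (𝒦.η : X → 𝒦.Kc X) := by
  refine IsInducing.isEmbedding ⟨?_⟩
  ext t
  rw [isOpen_induced_iff]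
  constructor
  · intro ht
    refine ⟨_, 𝒦.isOpen_Kc_iff.2 ⟨⟨t, ht⟩, rfl⟩, ?_⟩
    ext x
    exact Sobrification.unit_mem_hit x ⟨t, ht⟩
  · rintro ⟨s, hs, rfl⟩
    exact hs.preimage 𝒦.continuous_η

/-- An open set of the completion is determined by its trace on the original space. -/
theorem eq_of_isOpen {s t : Set (𝒦.Kc X)} (hs : IsOpen s) (ht : IsOpen t)
    (h : ∀ x, 𝒦.η x ∈ s ↔ 𝒦.η x ∈ t) : s = t := by
  obtain ⟨U, rfl⟩ := 𝒦.isOpen_Kc_iff.1 hs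
  obtain ⟨V, rfl⟩ := 𝒦.isOpen_Kc_iff.1 ht
  have : U = V := Opens.ext (Set.ext fun x =>
    (Sobrification.unit_mem_hit x U).symm.trans ((h x).trans (Sobrification.unit_mem_hit x V)))
  rw [this]

/-- Continuous maps from the completion to a `T₀` space are determined on the original space. -/
theorem eq_of_η [T0Space Z] {f g : 𝒦.Kc X → Z} (hf : Continuous f) (hg : Continuous g)
    (h : ∀ x, f (𝒦.η x) = g (𝒦.η x)) (a : 𝒦.Kc X) : f a = g a := by
  have : Inseparable (f a) (g a) := by
    rw [inseparable_iff_forall_isOpen]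
    intro s hs
    have := 𝒦.eq_of_isOpen (hs.preimage hf) (hs.preimage hg) fun x => by
      rw [mem_preimage, mem_preimage, h]
    exact Set.ext_iff.1 this a
  exact this.eq

/-- Only continuity in each variable separately is needed: the identity is extended in the second
variable at points `η x`, then in the first. -/
theorem eq_of_η₂ [T0Space Z] {f g : 𝒦.Kc X → 𝒦.Kc Y → Z}
    (hf : Continuous fun p : _ × _ => f p.1 p.2)
    (hg : Continuous fun p : _ × _ => g p.1 p.2)
    (h : ∀ x y, f (𝒦.η x) (𝒦.η y) = g (𝒦.η x) (𝒦.η y)) (a : 𝒦.Kc X) (b : 𝒦.Kc Y) :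
    f a b = g a b :=
  𝒦.eq_of_η (f := fun a => f a b) (g := fun a => g a b)
    (hf.comp (by fun_prop : Continuous fun a => (a, b)))
    (hg.comp (by fun_prop : Continuous fun a => (a, b)))
    (fun x => 𝒦.eq_of_η (hf.comp (by fun_prop : Continuous fun b => (𝒦.η x, b)))
      (hg.comp (by fun_prop : Continuous fun b => (𝒦.η x, b))) (h x) b) a

theorem map_map_of_leftInverse {f : C(X, Y)} {g : C(Y, X)} (h : ∀ x, g (f x) = x) (a : 𝒦.Kc X) :
    𝒦.map g (𝒦.map f a) = a :=
  𝒦.eq_of_η ((𝒦.map g).continuous.comp (𝒦.map f).continuous) continuous_id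
    (fun x => by rw [Function.comp_apply, map_η, map_η, h, id]) a

/-! ### The operations on the completion of the space of simple valuations -/

theorem vkHomeo_vkAdd (a b : 𝒦.Kc (Vs X)) :
    𝒦.vkHomeo (𝒦.vkAdd a b) = 𝒦.vkHomeo a + 𝒦.vkHomeo b := 𝒦.vkHomeo.apply_symm_apply _

theorem vkHomeo_vkSMul (r : ℝ≥0) (a : 𝒦.Kc (Vs X)) :
    𝒦.vkHomeo (𝒦.vkSMul r a) = r • 𝒦.vkHomeo a := 𝒦.vkHomeo.apply_symm_apply _

theorem vkAdd_η (μ ν : Vs X) : 𝒦.vkAdd (𝒦.η μ) (𝒦.η ν) = 𝒦.η (μ + ν) := by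
  refine 𝒦.vkHomeo.injective (Subtype.ext ?_)
  rw [vkHomeo_vkAdd, vkHomeo_η, Submodule.coe_add, vkHomeo_η, vkHomeo_η, Submodule.coe_add]

theorem vkSMul_η (r : ℝ≥0) (μ : Vs X) : 𝒦.vkSMul r (𝒦.η μ) = 𝒦.η (r • μ) := by
  refine 𝒦.vkHomeo.injective (Subtype.ext ?_)
  rw [vkHomeo_vkSMul, vkHomeo_η, Submodule.coe_smul, vkHomeo_η, Submodule.coe_smul]

theorem continuous_vkAdd : Continuous fun p : 𝒦.Kc (Vs X) × 𝒦.Kc (Vs X) => 𝒦.vkAdd p.1 p.2 := by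
  refine 𝒦.vkHomeo.symm.continuous.comp (Continuous.subtype_mk ?_ _)
  exact (continuous_subtype_val.comp (𝒦.vkHomeo.continuous.comp continuous_fst)).add
    (continuous_subtype_val.comp (𝒦.vkHomeo.continuous.comp continuous_snd))

theorem continuous_vkSMul : Continuous fun p : WithScott ℝ≥0 × 𝒦.Kc (Vs X) =>
    𝒦.vkSMul (WithScott.ofScott p.1) p.2 := by
  refine 𝒦.vkHomeo.symm.continuous.comp (Continuous.subtype_mk ?_ _)
  exact ContVal.continuous_scott_smul.comp (continuous_fst.prodMk
    (continuous_subtype_val.comp (𝒦.vkHomeo.continuous.comp continuous_snd)))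

/-! ### The cone structure on the completion of a cone -/

section

variable {C : Type u} [TopologicalSpace C] (α : C(Vs C, C))

/-- The addition induced on the completion by a map `V_s C → C`. -/
noncomputable def algAdd (x y : 𝒦.Kc C) : 𝒦.Kc C :=
  𝒦.map α (𝒦.vkAdd (𝒦.map (diracS C) x) (𝒦.map (diracS C) y))

/-- The scalar multiplication induced on the completion by a map `V_s C → C`. -/
noncomputable def algSMul (r : ℝ≥0) (x : 𝒦.Kc C) : 𝒦.Kc C :=
  𝒦.map α (𝒦.vkSMul r (𝒦.map (diracS C) x))

variable {α}

theorem _root_.Continuous.algAdd {T : Type*} [TopologicalSpace T] {f g : T → 𝒦.Kc C}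
    (hf : Continuous f) (hg : Continuous g) : Continuous fun t => 𝒦.algAdd α (f t) (g t) := by
  have h1 : Continuous fun t => (𝒦.map (diracS C) (f t), 𝒦.map (diracS C) (g t)) :=
    ((𝒦.map (diracS C)).continuous.comp hf).prodMk ((𝒦.map (diracS C)).continuous.comp hg)
  have h2 := 𝒦.continuous_vkAdd.comp h1
  exact (𝒦.map α).continuous.comp h2

theorem continuous_algSMul : Continuous fun p : WithScott ℝ≥0 × 𝒦.Kc C =>
    𝒦.algSMul α (WithScott.ofScott p.1) p.2 := by
  have h1 : Continuous fun p : WithScott ℝ≥0 × 𝒦.Kc C => (p.1, 𝒦.map (diracS C) p.2) :=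
    continuous_fst.prodMk ((𝒦.map (diracS C)).continuous.comp continuous_snd)
  have h2 := 𝒦.continuous_vkSMul.comp h1
  exact (𝒦.map α).continuous.comp h2

theorem _root_.Continuous.algSMul {T : Type*} [TopologicalSpace T] {f : T → 𝒦.Kc C} (r : ℝ≥0)
    (hf : Continuous f) : Continuous fun t => 𝒦.algSMul α r (f t) := by
  have h1 : Continuous fun t => (WithScott.toScott r, f t) := continuous_const.prodMk hf
  have h2 := (𝒦.continuous_algSMul (α := α)).comp h1
  exact h2

variable [AddCommMonoid C] [Module ℝ≥0 C]

/-- Together with `algSMul_η`, this reduces the cone laws on the completion to those of `C`, and it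
gives the linearity of `η`. -/
theorem algAdd_η (hα : IsStructureMap α) (x y : C) :
    𝒦.algAdd α (𝒦.η x) (𝒦.η y) = 𝒦.η (x + y) := by
  rw [algAdd, map_η, map_η, vkAdd_η, map_η, hα.linear.map_add, hα.unit_law, hα.unit_law]

theorem algSMul_η (hα : IsStructureMap α) (r : ℝ≥0) (x : C) :
    𝒦.algSMul α r (𝒦.η x) = 𝒦.η (r • x) := by
  rw [algSMul, map_η, vkSMul_η, map_η, hα.linear.map_smul, hα.unit_law]

/-- The completion of the structure map is additive. -/
theorem map_vkAdd (hα : IsStructureMap α) (a b : 𝒦.Kc (Vs C)) :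
    𝒦.map α (𝒦.vkAdd a b) = 𝒦.algAdd α (𝒦.map α a) (𝒦.map α b) := by
  refine 𝒦.eq_of_η₂ (f := fun a b => 𝒦.map α (𝒦.vkAdd a b))
    (g := fun a b => 𝒦.algAdd α (𝒦.map α a) (𝒦.map α b))
    ((𝒦.map α).continuous.comp 𝒦.continuous_vkAdd)
    (((𝒦.map α).continuous.comp continuous_fst).algAdd 𝒦
      ((𝒦.map α).continuous.comp continuous_snd)) (fun μ ν => ?_) a b
  simp only [vkAdd_η, map_η, 𝒦.algAdd_η hα, hα.linear.map_add]

/-- The completion of the structure map is homogeneous. -/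
theorem map_vkSMul (hα : IsStructureMap α) (r : ℝ≥0) (a : 𝒦.Kc (Vs C)) :
    𝒦.map α (𝒦.vkSMul r a) = 𝒦.algSMul α r (𝒦.map α a) := by
  refine 𝒦.eq_of_η (f := fun a => 𝒦.map α (𝒦.vkSMul r a))
    (g := fun a => 𝒦.algSMul α r (𝒦.map α a))
    ((𝒦.map α).continuous.comp (𝒦.continuous_vkSMul.comp
      ((continuous_const (y := WithScott.toScott r)).prodMk continuous_id)))
    ((𝒦.map α).continuous.algSMul 𝒦 r) (fun μ => ?_) a
  simp only [vkSMul_η, map_η, 𝒦.algSMul_η hα, hα.linear.map_smul]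

/-- The additive monoid structure on the completion of a cone. -/
@[reducible]
noncomputable def kcAddCommMonoid (hα : IsStructureMap α) : AddCommMonoid (𝒦.Kc C) where
  add := 𝒦.algAdd α
  zero := 𝒦.η 0
  nsmul := @nsmulRec _ ⟨𝒦.η 0⟩ ⟨𝒦.algAdd α⟩
  add_assoc x y z := by
    change 𝒦.algAdd α (𝒦.algAdd α x y) z = 𝒦.algAdd α x (𝒦.algAdd α y z)
    -- Three variables are treated by extending in `x` alone and then in `y` and `z` jointly.
    refine 𝒦.eq_of_η (((continuous_id.algAdd 𝒦 continuous_const).algAdd 𝒦 continuous_const))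
      (continuous_id.algAdd 𝒦 continuous_const) (fun x => ?_) x
    refine 𝒦.eq_of_η₂ (f := fun y z => 𝒦.algAdd α (𝒦.algAdd α (𝒦.η x) y) z)
      (g := fun y z => 𝒦.algAdd α (𝒦.η x) (𝒦.algAdd α y z))
      ((continuous_const.algAdd 𝒦 continuous_fst).algAdd 𝒦 continuous_snd)
      (continuous_const.algAdd 𝒦 (continuous_fst.algAdd 𝒦 continuous_snd)) (fun y z => ?_) y z
    simp only [𝒦.algAdd_η hα, add_assoc]
  zero_add x := by
    change 𝒦.algAdd α (𝒦.η 0) x = x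
    refine 𝒦.eq_of_η (continuous_const.algAdd 𝒦 continuous_id) continuous_id (fun x => ?_) x
    simp only [id, 𝒦.algAdd_η hα, zero_add]
  add_zero x := by
    change 𝒦.algAdd α x (𝒦.η 0) = x
    refine 𝒦.eq_of_η (continuous_id.algAdd 𝒦 continuous_const) continuous_id (fun x => ?_) x
    simp only [id, 𝒦.algAdd_η hα, add_zero]
  add_comm x y := by
    change 𝒦.algAdd α x y = 𝒦.algAdd α y x
    refine 𝒦.eq_of_η₂ (f := fun x y => 𝒦.algAdd α x y) (g := fun x y => 𝒦.algAdd α y x)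
      (continuous_fst.algAdd 𝒦 continuous_snd) (continuous_snd.algAdd 𝒦 continuous_fst)
      (fun x y => ?_) x y
    simp only [𝒦.algAdd_η hα, add_comm]

/-- The cone structure on the completion of a cone. -/
@[reducible]
noncomputable def kcModule (hα : IsStructureMap α) :
    letI := 𝒦.kcAddCommMonoid hα
    Module ℝ≥0 (𝒦.Kc C) :=
  letI := 𝒦.kcAddCommMonoid hα
  { smul := 𝒦.algSMul α
    one_smul := fun x => by
      change 𝒦.algSMul α 1 x = x
      refine 𝒦.eq_of_η (continuous_id.algSMul 𝒦 1) continuous_id (fun x => ?_) x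
      simp only [id, 𝒦.algSMul_η hα, one_smul]
    mul_smul := fun r s x => by
      change 𝒦.algSMul α (r * s) x = 𝒦.algSMul α r (𝒦.algSMul α s x)
      refine 𝒦.eq_of_η (continuous_id.algSMul 𝒦 _) ((continuous_id.algSMul 𝒦 s).algSMul 𝒦 r)
        (fun x => ?_) x
      simp only [id, 𝒦.algSMul_η hα, mul_smul]
    smul_zero := fun r => by
      change 𝒦.algSMul α r (𝒦.η 0) = 𝒦.η 0
      rw [𝒦.algSMul_η hα, smul_zero]
    smul_add := fun r x y => by
      change 𝒦.algSMul α r (𝒦.algAdd α x y) = 𝒦.algAdd α (𝒦.algSMul α r x) (𝒦.algSMul α r y)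
      refine 𝒦.eq_of_η₂ (f := fun x y => 𝒦.algSMul α r (𝒦.algAdd α x y))
        (g := fun x y => 𝒦.algAdd α (𝒦.algSMul α r x) (𝒦.algSMul α r y))
        ((continuous_fst.algAdd 𝒦 continuous_snd).algSMul 𝒦 r)
        ((continuous_fst.algSMul 𝒦 r).algAdd 𝒦 (continuous_snd.algSMul 𝒦 r)) (fun x y => ?_) x y
      simp only [𝒦.algAdd_η hα, 𝒦.algSMul_η hα, smul_add]
    add_smul := fun r s x => by
      change 𝒦.algSMul α (r + s) x = 𝒦.algAdd α (𝒦.algSMul α r x) (𝒦.algSMul α s x)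
      refine 𝒦.eq_of_η (continuous_id.algSMul 𝒦 _)
        ((continuous_id.algSMul 𝒦 r).algAdd 𝒦 (continuous_id.algSMul 𝒦 s)) (fun x => ?_) x
      simp only [id, 𝒦.algAdd_η hα, 𝒦.algSMul_η hα, add_smul]
    zero_smul := fun x => by
      change 𝒦.algSMul α 0 x = 𝒦.η 0
      refine 𝒦.eq_of_η (continuous_id.algSMul 𝒦 0) continuous_const (fun x => ?_) x
      simp only [id, 𝒦.algSMul_η hα, zero_smul] }

/-- The completion of a cone with a structure map is weakly locally convex, being a linear retract
of a locally convex cone of valuations. -/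
theorem isWeaklyLocallyConvex_Kc (hα : IsStructureMap α) :
    @IsWeaklyLocallyConvex (𝒦.Kc C) _ (𝒦.kcAddCommMonoid hα) (𝒦.kcModule hα) := by
  intro x U hU hx
  have hret : ∀ y : 𝒦.Kc C, 𝒦.map α (𝒦.map (diracS C) y) = y := 𝒦.map_map_of_leftInverse hα.unit_law
  obtain ⟨s, hs, hsU⟩ := isOpen_induced_iff.1
    (hU.preimage ((𝒦.map α).continuous.comp 𝒦.vkHomeo.symm.continuous))
  have hsU' : ∀ m : 𝒦.Kc (Vs C), (𝒦.vkHomeo m : ContVal C) ∈ s ↔ 𝒦.map α m ∈ U := fun m => by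
    have := Set.ext_iff.1 hsU (𝒦.vkHomeo m)
    rwa [mem_preimage, mem_preimage, Function.comp_apply, Homeomorph.symm_apply_apply] at this
  obtain ⟨A, hA, hxA, hAs, hAc⟩ := ContVal.exists_isOpen_convex hs
    ((hsU' (𝒦.map (diracS C) x)).2 (by rwa [hret]))
  -- The image under `Kc(α)` of the part of `A` inside the completion of `V_s C`. It contains the
  -- open preimage of `A` under `Kc(δ)` by the retraction identity, and it is convex because `Kc(α)`
  -- is linear; it is not claimed to be open.
  refine ⟨{z | ∃ m : 𝒦.Kc (Vs C), (𝒦.vkHomeo m : ContVal C) ∈ A ∧ 𝒦.map α m = z}, ?_, ?_, ?_⟩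
  · refine Filter.mem_of_superset ((hA.preimage (continuous_subtype_val.comp
      (𝒦.vkHomeo.continuous.comp (𝒦.map (diracS C)).continuous))).mem_nhds hxA) fun y hy => ?_
    exact ⟨_, hy, hret y⟩
  · rintro _ ⟨m, hm, rfl⟩
    exact (hsU' m).1 (hAs hm)
  · rintro _ ⟨m, hm, rfl⟩ _ ⟨m', hm', rfl⟩ a b ha hb hab
    refine ⟨𝒦.vkAdd (𝒦.vkSMul a m) (𝒦.vkSMul b m'), ?_, ?_⟩
    · rw [vkHomeo_vkAdd, vkHomeo_vkSMul, vkHomeo_vkSMul]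
      exact hAc hm hm' ha hb hab
    · rw [𝒦.map_vkAdd hα, 𝒦.map_vkSMul hα, 𝒦.map_vkSMul hα]
      rfl

end

end KCategory

theorem mainTheorem7 (𝒦 : KCategory.{u}) (C : Type u) [TopologicalSpace C] [AddCommMonoid C]
    [Module ℝ≥0 C] (hC : IsTopologicalCone C) (hwlc : IsWeaklyLocallyConvex C) :
    (∃! α : C(Vs C, C), IsStructureMap α) ∧
    ∀ α : C(Vs C, C), IsStructureMap α →
      ∃ (_ : AddCommMonoid (𝒦.Kc C)) (_ : Module ℝ≥0 (𝒦.Kc C)),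
        (∀ x y : 𝒦.Kc C,
          x + y = 𝒦.map α (𝒦.vkAdd (𝒦.map (diracS C) x) (𝒦.map (diracS C) y))) ∧
        (∀ (r : ℝ≥0) (x : 𝒦.Kc C),
          r • x = 𝒦.map α (𝒦.vkSMul r (𝒦.map (diracS C) x))) ∧
        IsTopologicalCone (𝒦.Kc C) ∧
        IsWeaklyLocallyConvex (𝒦.Kc C) ∧
        𝒦.IsKSpace (𝒦.Kc C) ∧
        IsEmbedding (𝒦.η : C → 𝒦.Kc C) ∧
        IsLinearMap ℝ≥0 (𝒦.η : C → 𝒦.Kc C) := by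
  refine ⟨?_, fun α hα => ?_⟩
  · obtain ⟨α, hα⟩ := hwlc.exists_isStructureMap hC
    exact ⟨α, hα, fun β hβ => hβ.eq hα⟩
  · have := hC.t0
    let _ := 𝒦.kcAddCommMonoid hα
    let _ := 𝒦.kcModule hα
    refine ⟨𝒦.kcAddCommMonoid hα, 𝒦.kcModule hα, fun _ _ => rfl, fun _ _ => rfl,
      ⟨inferInstance, continuous_fst.algAdd 𝒦 continuous_snd, 𝒦.continuous_algSMul⟩,
      𝒦.isWeaklyLocallyConvex_Kc hα, 𝒦.isKSpace_Kc C, 𝒦.isEmbedding_η,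
      ⟨fun x y => (𝒦.algAdd_η hα x y).symm, fun r x => (𝒦.algSMul_η hα r x).symm⟩⟩
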